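/- Conventions. For a unital C$^*$-algebra $M$ put $\mathbb H_+(M)=\{T\in M : \operatorname{Im}T\ge \varepsilon 1 \text{ for some }\varepsilon>0\}$, where $\operatorname{Im}T=(T-T^*)/2i$, and let $M_n(M)$ be the C$^*$-algebra of $n\times n$ matrices over $M$. Let $K$ be a unital C$^*$-algebra, $1\in A\subset K$ a C$^*$-subalgebra and $X\in K$. Write $A\langle X\rangle$ for the (algebraic) subalgebra of $K$ generated by $A$ and $X$. The element $X$ is algebraically free from $A$ if the evaluation $P\mapsto P(X)$ from the ring $A\langle t\rangle$ of noncommutative polynomials with coefficients in $A$ (the free product of $A$ and $\mathbb C[t]$ over $\mathbb C$) to $K$ is injective. In that case the free difference quotient $\partial_{X:A}:A\langle X\rangle\to A\langle X\rangle\otimes A\langle X\rangle$ (algebraic tensor product over $\mathbb C$) is the unique derivation, for the bimodule structure $p\cdot(x\otimes y)\cdot q=px\otimes yq$, with $\partial_{X:A}(a)=0$ for $a\in A$ and $\partial_{X:A}(X)=1\otimes 1$. It is called closable if, as an unbounded operator from $K$ to the minimal (spatial) C$^*$-tensor product $K\otimes_{\min} K$ with domain $A\langle X\rangle$, the closure of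 its graph (for the norms of $K$ and $K\otimes_{\min}K$) is a graph. Theorem. Let $K$ and $L$ be unital C$^*$-algebras, and $1\in A\subset K$, $1\in B\subset L$ C$^*$-subalgebras. Let $X=X^*\in K$ be algebraically free from $A$ and $Y=Y^*\in L$ algebraically free from $B$. Suppose $\Psi:L\to K$ is a unital completely positive linear map such that $\Psi(B\langle Y\rangle)\subset A\langle X\rangle$ and $$(\Psi\otimes\Psi)\circ\partial_{Y:B}=\partial_{X:A}\circ\Psi|_{B\langle Y\rangle}.$$ Suppose also that $\partial_{X:A}$ and $\partial_{Y:B}$ are closable. Then for every $n$ there is a holomorphic map $F_n:\mathbb H_+(M_n(B))\to\mathbb H_+(M_n(A))$ such that for every $\beta\in\mathbb H_+(M_n(B))$ the matrices $Y\otimes I_n-\beta$ and $X\otimes I_n-F_n(\beta)$ are invertible in $M_n(L)$ and $M_n(K)$ respectively, and $$M_n(\Psi)\big((Y\otimes I_n-\beta)^{-1}\big)=\big(X\otimes I_n-F_n(\beta)\big)^{-1},$$ where $M_n(\Psi)$ is $\Psi$ applied entrywise. -/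

import Mathlib

open scoped TensorProduct CStarAlgebra ComplexStarModule

universe u v

/-! ## Noncommutative polynomials `A⟨t⟩` over a complex algebra `A` -/

/-- The relations that make `a ↦ ι (some a)` a homomorphism of unital complex algebras. -/
inductive NCPolynomial.Rel (A : Type u) [Ring A] [Algebra ℂ A] :
    FreeAlgebra ℂ (Option A) → FreeAlgebra ℂ (Option A) → Prop
  | add (a b : A) : Rel A (FreeAlgebra.ι ℂ (some (a + b)))
      (FreeAlgebra.ι ℂ (some a) + FreeAlgebra.ι ℂ (some b))
  | mul (a b : A) : Rel A (FreeAlgebra.ι ℂ (some (a * b)))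
      (FreeAlgebra.ι ℂ (some a) * FreeAlgebra.ι ℂ (some b))
  | scalar (r : ℂ) : Rel A (FreeAlgebra.ι ℂ (some (algebraMap ℂ A r))) (algebraMap ℂ _ r)

/-- `A⟨t⟩`, the ring of polynomials in an indeterminate `t` that does not commute with the
coefficients; it is the free product (over `ℂ`, with amalgamated units) of `A` and `ℂ[t]`.
In the presentation, `ι (some a)` stands for the coefficient `a` and `ι none` for `t`. -/
abbrev NCPolynomial (A : Type u) [Ring A] [Algebra ℂ A] : Type u :=
  RingQuot (NCPolynomial.Rel A)

namespace NCPolynomial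

variable {A : Type u} [Ring A] [Algebra ℂ A] {S : Type v} [Ring S] [Algebra ℂ S]

/-- The indeterminate. -/
noncomputable def var (A : Type u) [Ring A] [Algebra ℂ A] : NCPolynomial A :=
  RingQuot.mkAlgHom ℂ (Rel A) (FreeAlgebra.ι ℂ none)

/-- A coefficient as a constant polynomial. -/
noncomputable def const (a : A) : NCPolynomial A :=
  RingQuot.mkAlgHom ℂ (Rel A) (FreeAlgebra.ι ℂ (some a))

/-- The homomorphism out of `A⟨t⟩` that is `f` on the coefficients and sends `t` to `s`. -/
noncomputable def lift (f : A →ₐ[ℂ] S) (s : S) : NCPolynomial A →ₐ[ℂ] S :=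
  RingQuot.liftAlgHom ℂ
    ⟨FreeAlgebra.lift ℂ (fun o : Option A => o.elim s f), by
      intro x y h
      induction h <;> simp⟩

@[simp]
theorem lift_const (f : A →ₐ[ℂ] S) (s : S) (a : A) : lift f s (const a) = f a := by
  simp [lift, const]

@[simp]
theorem lift_var (f : A →ₐ[ℂ] S) (s : S) : lift f s (var A) = s := by
  simp [lift, var]

theorem adjoin_eq_top :
    Algebra.adjoin ℂ (Set.range (const (A := A)) ∪ {var A}) = ⊤ := by
  have h := congrArg (Subalgebra.map (RingQuot.mkAlgHom ℂ (Rel A)))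
    (FreeAlgebra.adjoin_range_ι ℂ (Option A))
  rw [AlgHom.map_adjoin, Algebra.map_top,
    (AlgHom.range_eq_top _).2 (RingQuot.mkAlgHom_surjective ℂ (Rel A))] at h
  rw [← h]
  congr 1
  ext p
  constructor
  · rintro (⟨a, rfl⟩ | rfl)
    · exact ⟨_, ⟨some a, rfl⟩, rfl⟩
    · exact ⟨_, ⟨none, rfl⟩, rfl⟩
  · rintro ⟨_, ⟨o, rfl⟩, rfl⟩
    cases o with
    | none => exact Or.inr rfl
    | some a => exact Or.inl ⟨a, rfl⟩

end NCPolynomial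

/-! ## The free difference quotient -/

section FreeDifferenceQuotient

variable {K : Type u} [CStarAlgebra K]

/-- `A⟨X⟩`, the (not closed) subalgebra of `K` generated by `A` and `X`. -/
def polyAlgebra (A : StarSubalgebra ℂ K) (X : K) : Subalgebra ℂ K :=
  Algebra.adjoin ℂ ((A : Set K) ∪ {X})

/-- Evaluation `A⟨t⟩ → K`, `P ↦ P(X)`. -/
noncomputable def polyEval (A : StarSubalgebra ℂ K) (X : K) : NCPolynomial A →ₐ[ℂ] K :=
  NCPolynomial.lift A.toSubalgebra.val X

/-- `X` is algebraically free from `A`: no nonzero polynomial in `A⟨t⟩` vanishes at `X`. -/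
def AlgebraicallyFree (A : StarSubalgebra ℂ K) (X : K) : Prop :=
  Function.Injective (polyEval A X)

theorem polyEval_range (A : StarSubalgebra ℂ K) (X : K) :
    (polyEval A X).range = polyAlgebra A X := by
  rw [← Algebra.map_top, ← NCPolynomial.adjoin_eq_top, AlgHom.map_adjoin, polyAlgebra]
  congr 1
  ext x
  constructor
  · rintro ⟨_, ⟨a, rfl⟩ | rfl, rfl⟩
    · left; simp [polyEval]
    · right; simp [polyEval]
  · rintro (hx | rfl)
    · exact ⟨_, Or.inl ⟨⟨x, hx⟩, rfl⟩, by simp [polyEval]⟩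
    · exact ⟨_, Or.inr rfl, by simp [polyEval]⟩

/-- If `X` is algebraically free from `A`, evaluation is an isomorphism `A⟨t⟩ ≃ A⟨X⟩`. -/
noncomputable def polyEquiv {A : StarSubalgebra ℂ K} {X : K} (h : AlgebraicallyFree A X) :
    NCPolynomial A ≃ₐ[ℂ] polyAlgebra A X :=
  (AlgEquiv.ofInjective (polyEval A X) h).trans
    (Subalgebra.equivOfEq _ _ (polyEval_range A X))

/-- `A` as a subalgebra of `A⟨X⟩`. -/
def polyCoeff (A : StarSubalgebra ℂ K) (X : K) : A →ₐ[ℂ] polyAlgebra A X :=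
  Subalgebra.inclusion (S := A.toSubalgebra)
    (fun _ hx => Algebra.subset_adjoin (Or.inl hx))

/-- `X` as an element of `A⟨X⟩`. -/
def polyGen (A : StarSubalgebra ℂ K) (X : K) : polyAlgebra A X :=
  ⟨X, Algebra.subset_adjoin (Or.inr rfl)⟩

/-- For any algebra `S`, the homomorphism `s ↦ diag (s ⊗ 1, 1 ⊗ s)` into `M₂(S ⊗ S)`. -/
noncomputable def diagTensor (S : Type u) [Ring S] [Algebra ℂ S] :
    S →ₐ[ℂ] Matrix (Fin 2) (Fin 2) (S ⊗[ℂ] S) :=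
  (Matrix.diagonalAlgHom ℂ).comp
    (AlgHom.pi (A := fun _ : Fin 2 => S ⊗[ℂ] S)
      ![Algebra.TensorProduct.includeLeft, Algebra.TensorProduct.includeRight])

/-- The homomorphism `A⟨t⟩ → M₂(A⟨X⟩ ⊗ A⟨X⟩)`,
`P ↦ !![P(X) ⊗ 1, (∂P)(X); 0, 1 ⊗ P(X)]`, which encodes the Leibniz rule for `∂`. -/
noncomputable def fdqHom (A : StarSubalgebra ℂ K) (X : K) :
    NCPolynomial A →ₐ[ℂ]
      Matrix (Fin 2) (Fin 2) (polyAlgebra A X ⊗[ℂ] polyAlgebra A X) :=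
  NCPolynomial.lift ((diagTensor (polyAlgebra A X)).comp (polyCoeff A X))
    (diagTensor (polyAlgebra A X) (polyGen A X) + Matrix.single 0 1 1)

/-- The free difference quotient `∂_{X:A} : A⟨X⟩ → A⟨X⟩ ⊗ A⟨X⟩` (algebraic tensor product), the
derivation with `∂ a = 0` for `a ∈ A` and `∂ X = 1 ⊗ 1`. -/
noncomputable def freeDifferenceQuotient {A : StarSubalgebra ℂ K} {X : K}
    (h : AlgebraicallyFree A X) :
    polyAlgebra A X →ₗ[ℂ] polyAlgebra A X ⊗[ℂ] polyAlgebra A X :=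
  (Matrix.entryLinearMap ℂ (polyAlgebra A X ⊗[ℂ] polyAlgebra A X) 0 1) ∘ₗ
    (fdqHom A X).toLinearMap ∘ₗ (polyEquiv h).symm.toLinearMap

/-- The free difference quotient with its values read in `K ⊗ K`. -/
noncomputable def freeDifferenceQuotientIn {A : StarSubalgebra ℂ K} {X : K}
    (h : AlgebraicallyFree A X) : polyAlgebra A X →ₗ[ℂ] K ⊗[ℂ] K :=
  TensorProduct.map (polyAlgebra A X).val.toLinearMap (polyAlgebra A X).val.toLinearMap ∘ₗ
    freeDifferenceQuotient h

theorem polyEquiv_const {A : StarSubalgebra ℂ K} {X : K} (h : AlgebraicallyFree A X) (a : A) :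
    polyEquiv h (NCPolynomial.const a) = polyCoeff A X a := by
  apply Subtype.ext
  change polyEval A X _ = _
  rw [polyEval, NCPolynomial.lift_const]
  rfl

theorem polyEquiv_var {A : StarSubalgebra ℂ K} {X : K} (h : AlgebraicallyFree A X) :
    polyEquiv h (NCPolynomial.var A) = polyGen A X := by
  apply Subtype.ext
  change polyEval A X _ = _
  simp [polyEval, polyGen]

theorem freeDifferenceQuotient_coeff {A : StarSubalgebra ℂ K} {X : K}
    (h : AlgebraicallyFree A X) (a : A) :
    freeDifferenceQuotient h (polyCoeff A X a) = 0 := by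
  simp [freeDifferenceQuotient, ← polyEquiv_const h, fdqHom, diagTensor]

theorem freeDifferenceQuotient_gen {A : StarSubalgebra ℂ K} {X : K}
    (h : AlgebraicallyFree A X) :
    freeDifferenceQuotient h (polyGen A X) = 1 ⊗ₜ 1 := by
  simp [freeDifferenceQuotient, ← polyEquiv_var h, fdqHom, diagTensor,
    Algebra.TensorProduct.one_def]

theorem fdqHom_entries {A : StarSubalgebra ℂ K} {X : K}
    (h : AlgebraicallyFree A X) (P : NCPolynomial A) :
    fdqHom A X P 0 0 = polyEquiv h P ⊗ₜ 1 ∧ fdqHom A X P 1 1 = 1 ⊗ₜ polyEquiv h P ∧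
      fdqHom A X P 1 0 = 0 := by
  have hP : P ∈ Algebra.adjoin ℂ
      (Set.range (NCPolynomial.const (A := A)) ∪ {NCPolynomial.var A}) := by
    rw [NCPolynomial.adjoin_eq_top]; trivial
  induction hP using Algebra.adjoin_induction with
  | mem x hx =>
    rcases hx with ⟨a, rfl⟩ | rfl
    · simp [fdqHom, diagTensor, polyEquiv_const]
    · simp [fdqHom, diagTensor, polyEquiv_var]
  | algebraMap r =>
    simp [Algebra.algebraMap_eq_smul_one, Algebra.TensorProduct.one_def,
      TensorProduct.smul_tmul']
  | add x y _ _ hx hy =>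
    simp [hx, hy, TensorProduct.add_tmul, TensorProduct.tmul_add]
  | mul x y _ _ hx hy =>
    simp [Matrix.mul_apply, hx, hy]

/-- The Leibniz rule. -/
theorem freeDifferenceQuotient_mul {A : StarSubalgebra ℂ K} {X : K}
    (h : AlgebraicallyFree A X) (p q : polyAlgebra A X) :
    freeDifferenceQuotient h (p * q) =
      (p ⊗ₜ 1) * freeDifferenceQuotient h q + freeDifferenceQuotient h p * (1 ⊗ₜ q) := by
  simp [freeDifferenceQuotient, Matrix.mul_apply, fdqHom_entries h]

end FreeDifferenceQuotient

/-! ## The minimal C⋆-tensor product -/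

section MinTensor

variable {K L : Type u} [CStarAlgebra K] [CStarAlgebra L]

/-- For representations `π₁`, `π₂` of `K`, `L` on Hilbert spaces `H₁`, `H₂`, the representation
`π₁ ⊗ π₂` of the algebraic tensor product `K ⊗ L` on the pre-Hilbert space `H₁ ⊗ H₂`. Passing to
the completion of `H₁ ⊗ H₂` changes no operator norm. -/
noncomputable def tensorRep {H₁ H₂ : Type u}
    [NormedAddCommGroup H₁] [InnerProductSpace ℂ H₁] [CompleteSpace H₁]
    [NormedAddCommGroup H₂] [InnerProductSpace ℂ H₂] [CompleteSpace H₂]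
    (π₁ : K →⋆ₐ[ℂ] (H₁ →L[ℂ] H₁)) (π₂ : L →⋆ₐ[ℂ] (H₂ →L[ℂ] H₂)) :
    K ⊗[ℂ] L →ₗ[ℂ] ((H₁ ⊗[ℂ] H₂) →L[ℂ] (H₁ ⊗[ℂ] H₂)) :=
  TensorProduct.lift
    (LinearMap.mk₂ ℂ (fun a b => TensorProduct.mapL (π₁ a) (π₂ b))
      (fun a a' b => by simp [TensorProduct.mapL_add_left])
      (fun c a b => by simp [TensorProduct.mapL_smul_left])
      (fun a b b' => by simp [TensorProduct.mapL_add_right])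
      (fun c a b => by simp [TensorProduct.mapL_smul_right]))

/-- The norms `‖(π₁ ⊗ π₂)(z)‖`, for all representations `π₁`, `π₂` on Hilbert spaces. -/
def minNormSet (z : K ⊗[ℂ] L) : Set ℝ :=
  {r | ∃ (H₁ H₂ : Type u)
    (_ : NormedAddCommGroup H₁) (_ : InnerProductSpace ℂ H₁) (_ : CompleteSpace H₁)
    (_ : NormedAddCommGroup H₂) (_ : InnerProductSpace ℂ H₂) (_ : CompleteSpace H₂)
    (π₁ : K →⋆ₐ[ℂ] (H₁ →L[ℂ] H₁)) (π₂ : L →⋆ₐ[ℂ] (H₂ →L[ℂ] H₂)),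
    r = ‖tensorRep π₁ π₂ z‖}

theorem minNormSet_nonempty (z : K ⊗[ℂ] L) : (minNormSet z).Nonempty := by
  have h1 : ∀ x y : (PUnit.{u+1} →L[ℂ] PUnit.{u+1}), x = y := fun x y => by ext
  refine ⟨_, PUnit, PUnit, inferInstance, inferInstance, inferInstance, inferInstance,
    inferInstance, inferInstance, ?_, ?_, rfl⟩
  · exact
      { toFun := fun _ => 0, map_one' := h1 _ _, map_mul' := fun _ _ => h1 _ _,
        map_zero' := rfl, map_add' := fun _ _ => h1 _ _, commutes' := fun _ => h1 _ _,
        map_star' := fun _ => h1 _ _ }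
  · exact
      { toFun := fun _ => 0, map_one' := h1 _ _, map_mul' := fun _ _ => h1 _ _,
        map_zero' := rfl, map_add' := fun _ _ => h1 _ _, commutes' := fun _ => h1 _ _,
        map_star' := fun _ => h1 _ _ }

theorem norm_tensorRep_mem {H₁ H₂ : Type u}
    [NormedAddCommGroup H₁] [InnerProductSpace ℂ H₁] [CompleteSpace H₁]
    [NormedAddCommGroup H₂] [InnerProductSpace ℂ H₂] [CompleteSpace H₂]
    (π₁ : K →⋆ₐ[ℂ] (H₁ →L[ℂ] H₁)) (π₂ : L →⋆ₐ[ℂ] (H₂ →L[ℂ] H₂)) (z : K ⊗[ℂ] L) :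
    ‖tensorRep π₁ π₂ z‖ ∈ minNormSet z :=
  ⟨H₁, H₂, _, _, ‹_›, _, _, ‹_›, π₁, π₂, rfl⟩

theorem forall_mem_minNormSet {z : K ⊗[ℂ] L} {p : ℝ → Prop}
    (h : ∀ (H₁ H₂ : Type u)
      [NormedAddCommGroup H₁] [InnerProductSpace ℂ H₁] [CompleteSpace H₁]
      [NormedAddCommGroup H₂] [InnerProductSpace ℂ H₂] [CompleteSpace H₂]
      (π₁ : K →⋆ₐ[ℂ] (H₁ →L[ℂ] H₁)) (π₂ : L →⋆ₐ[ℂ] (H₂ →L[ℂ] H₂)),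
      p ‖tensorRep π₁ π₂ z‖) : ∀ r ∈ minNormSet z, p r := by
  rintro r ⟨H₁, H₂, _, _, _, _, _, _, π₁, π₂, rfl⟩
  exact h H₁ H₂ π₁ π₂

theorem minNormSet_bddAbove (z : K ⊗[ℂ] L) : BddAbove (minNormSet z) := by
  induction z using TensorProduct.induction_on with
  | zero =>
    refine ⟨0, forall_mem_minNormSet ?_⟩
    intro H₁ H₂ _ _ _ _ _ _ π₁ π₂
    rw [map_zero]
    exact ContinuousLinearMap.opNorm_zero.le
  | tmul a b =>
    refine ⟨‖a‖ * ‖b‖, forall_mem_minNormSet ?_⟩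
    intro H₁ H₂ _ _ _ _ _ _ π₁ π₂
    have h : tensorRep π₁ π₂ (a ⊗ₜ[ℂ] b) = TensorProduct.mapL (π₁ a) (π₂ b) := by
      simp [tensorRep]
    rw [h]
    exact (TensorProduct.norm_mapL_le _ _).trans
      (mul_le_mul (NonUnitalStarAlgHom.norm_apply_le π₁ a) (NonUnitalStarAlgHom.norm_apply_le π₂ b)
        (norm_nonneg _) (norm_nonneg _))
  | add x y hx hy =>
    obtain ⟨c, hc⟩ := hx
    obtain ⟨d, hd⟩ := hy
    refine ⟨c + d, forall_mem_minNormSet ?_⟩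
    intro H₁ H₂ _ _ _ _ _ _ π₁ π₂
    rw [map_add]
    exact (ContinuousLinearMap.opNorm_add_le _ _).trans (add_le_add (hc (norm_tensorRep_mem π₁ π₂ x))
      (hd (norm_tensorRep_mem π₁ π₂ y)))

/-- The minimal (spatial) C⋆-norm on the algebraic tensor product,
`‖z‖ = sup ‖(π₁ ⊗ π₂)(z)‖` over all representations `π₁` of `K` and `π₂` of `L`. -/
noncomputable def minTensorSeminorm (K L : Type u) [CStarAlgebra K] [CStarAlgebra L] :
    Seminorm ℂ (K ⊗[ℂ] L) :=
  Seminorm.ofSMulLE (fun z => sSup (minNormSet z))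
    (by
      refine le_antisymm (csSup_le (minNormSet_nonempty _) (forall_mem_minNormSet ?_))
        (Real.sSup_nonneg (forall_mem_minNormSet ?_))
      · intro H₁ H₂ _ _ _ _ _ _ π₁ π₂
        rw [map_zero]
        exact ContinuousLinearMap.opNorm_zero.le
      · intro H₁ H₂ _ _ _ _ _ _ π₁ π₂
        exact ContinuousLinearMap.opNorm_nonneg _)
    (by
      intro x y
      refine csSup_le (minNormSet_nonempty _) (forall_mem_minNormSet ?_)
      intro H₁ H₂ _ _ _ _ _ _ π₁ π₂
      rw [map_add]
      exact (ContinuousLinearMap.opNorm_add_le _ _).trans (add_le_add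
        (le_csSup (minNormSet_bddAbove x) (norm_tensorRep_mem π₁ π₂ x))
        (le_csSup (minNormSet_bddAbove y) (norm_tensorRep_mem π₁ π₂ y))))
    (by
      intro c x
      refine csSup_le (minNormSet_nonempty _) (forall_mem_minNormSet ?_)
      intro H₁ H₂ _ _ _ _ _ _ π₁ π₂
      rw [map_smul]
      exact (ContinuousLinearMap.opNorm_smul_le _ _).trans (mul_le_mul_of_nonneg_left
        (le_csSup (minNormSet_bddAbove x) (norm_tensorRep_mem π₁ π₂ x)) (norm_nonneg _)))

/-- The algebraic tensor product, carrying the minimal C⋆-norm. -/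
def PreMinTensor (K L : Type u) [CStarAlgebra K] [CStarAlgebra L] : Type u := K ⊗[ℂ] L

noncomputable instance : AddCommGroup (PreMinTensor K L) :=
  inferInstanceAs (AddCommGroup (K ⊗[ℂ] L))

noncomputable instance : Module ℂ (PreMinTensor K L) :=
  inferInstanceAs (Module ℂ (K ⊗[ℂ] L))

noncomputable instance : SeminormedAddCommGroup (PreMinTensor K L) :=
  AddGroupSeminorm.toSeminormedAddCommGroup (E := PreMinTensor K L)
    (minTensorSeminorm K L).toAddGroupSeminorm

noncomputable instance : NormedSpace ℂ (PreMinTensor K L) where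
  norm_smul_le c z := (map_smul_eq_mul (minTensorSeminorm K L) c z).le

/-- The minimal (spatial) tensor product `K ⊗_min L`, as a Banach space. -/
abbrev MinTensor (K L : Type u) [CStarAlgebra K] [CStarAlgebra L] : Type u :=
  UniformSpace.Completion (PreMinTensor K L)

/-- The canonical map of the algebraic tensor product into `K ⊗_min L`. -/
noncomputable def toMinTensor (K L : Type u) [CStarAlgebra K] [CStarAlgebra L] :
    K ⊗[ℂ] L →ₗ[ℂ] MinTensor K L :=
  (UniformSpace.Completion.toComplₗᵢ (𝕜 := ℂ) (E := PreMinTensor K L)).toLinearMap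

end MinTensor

/-- `∂_{X:A}` as a partially defined operator `K → K ⊗_min K` with domain `A⟨X⟩`. -/
noncomputable def freeDifferenceQuotientOp {K : Type u} [CStarAlgebra K]
    {A : StarSubalgebra ℂ K} {X : K} (h : AlgebraicallyFree A X) : K →ₗ.[ℂ] MinTensor K K where
  domain := Subalgebra.toSubmodule (polyAlgebra A X)
  toFun := toMinTensor K K ∘ₗ freeDifferenceQuotientIn h

/-! ## Half-planes and matrices -/

/-- The order of a C⋆-algebra, restricted to a C⋆-subalgebra, is the order of the subalgebra. -/
instance StarSubalgebra.starOrderedRingOfIsClosed {K : Type u} [CStarAlgebra K] [PartialOrder K]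
    [StarOrderedRing K] (A : StarSubalgebra ℂ K) [IsClosed (A : Set K)] : StarOrderedRing A := by
  refine StarOrderedRing.of_nonneg_iff' (fun {x y} hxy z => ?_) (fun x => ⟨fun hx => ?_, ?_⟩)
  · exact add_le_add_right (α := K) hxy (z : K)
  · have hx' : (0 : K) ≤ x := hx
    have hmem : CFC.sqrt (x : K) ∈ A := by
      rw [CFC.sqrt_eq_real_sqrt _ hx']
      exact cfcₙ_mem (𝕜' := ℂ) Real.sqrt x.2
    refine ⟨⟨CFC.sqrt (x : K), hmem⟩, Subtype.ext ?_⟩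
    change (x : K) = star (CFC.sqrt (x : K)) * CFC.sqrt (x : K)
    rw [(CFC.sqrt_nonneg (x : K)).isSelfAdjoint.star_eq, CFC.sqrt_mul_sqrt_self _ hx']
  · rintro ⟨s, rfl⟩
    exact star_mul_self_nonneg (s : K)

/-- The upper half-plane `{T : Im T ≥ ε 1 for some ε > 0}` of a unital C⋆-algebra. -/
def upperHalfPlane (M : Type u) [CStarAlgebra M] [PartialOrder M] : Set M :=
  {T | ∃ ε : ℝ, 0 < ε ∧ algebraMap ℂ M (ε : ℂ) ≤ (ℑ T : M)}

/-- `T ⊗ I_n`, the `n × n` matrix with `T` on the diagonal. -/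
def tensorOne {K : Type u} [CStarAlgebra K] (T : K) (n : ℕ) : CStarMatrix (Fin n) (Fin n) K :=
  CStarMatrix.ofMatrix (Matrix.diagonal fun _ => T)

/-!
The equation forces `F(β) = X - Ψ((Y - β)⁻¹)⁻¹`, where all maps are applied entrywise; since `Ψ` is
unital and positive on matrices it sends the resolvent `(Y - β)⁻¹` into the half-plane, so this
formula makes sense, is holomorphic in `β` and takes values in the half-plane of `M_n(K)`. What has
to be shown is that its values have entries in `A`.

Replace `Y` and `X` by `tY` and `tX` and expand `tX - Ψ((tY - β)⁻¹)⁻¹` as a formal power series in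
`t`. Its coefficients have entries in `A⟨X⟩`, where the difference quotient is defined. Since
`∂(w⁻¹) = -w⁻¹ (∂w) w⁻¹` and `Ψ` intertwines the two difference quotients, `∂_X` kills this series;
as the kernel of `∂_X` is `A`, the coefficients have entries in `A`. The function is real-analytic
on all of `ℝ`, because `tY` is self-adjoint for every real `t`, and its Taylor coefficients at
`t = 0` lie in the closed subspace `M_n(A)`; by the identity theorem so does its value at `t = 1`.
-/

/-! ## Half-planes of C⋆-algebras -/

section UpperHalfPlane

variable {M N : Type*} [CStarAlgebra M] [CStarAlgebra N]

theorem algebraMap_complex_ofReal (r : ℝ) : algebraMap ℂ M (r : ℂ) = algebraMap ℝ M r :=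
  (IsScalarTower.algebraMap_apply ℝ ℂ M r).symm

theorem isUnit_add_I_of_isSelfAdjoint {h : M} (hh : IsSelfAdjoint h) :
    IsUnit (h + algebraMap ℂ M Complex.I) := by
  have hI : -Complex.I ∉ spectrum ℂ h := fun hmem => by
    simpa using hh.im_eq_zero_of_mem_spectrum hmem
  rw [spectrum.notMem_iff] at hI
  simpa only [map_neg, neg_sub, sub_neg_eq_add] using hI.neg

theorem imaginaryPart_eq_smul_sub_star (T : M) :
    (ℑ T : M) = ((2 : ℂ)⁻¹ * -Complex.I) • (T - star T) := by
  rw [imaginaryPart_apply_coe, mul_comm, mul_smul, ← Complex.coe_smul]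
  norm_num

theorem imaginaryPart_neg_inv (T : Mˣ) :
    (ℑ (-(↑T⁻¹ : M)) : M) = (↑T⁻¹ : M) * (ℑ (T : M) : M) * star (↑T⁻¹ : M) := by
  have hT : star (T : M) * star (↑T⁻¹ : M) = 1 := by rw [← star_mul, T.inv_mul, star_one]
  simp only [imaginaryPart_eq_smul_sub_star, mul_smul_comm, smul_mul_assoc, mul_sub, sub_mul,
    T.inv_mul, one_mul, mul_assoc, hT, mul_one, star_neg, neg_sub_neg]

theorem sub_mem_upperHalfPlane [PartialOrder M] {T a : M} (hT : T ∈ upperHalfPlane M)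
    (ha : IsSelfAdjoint a) : T - a ∈ upperHalfPlane M := by
  obtain ⟨ε, hε, hle⟩ := hT
  refine ⟨ε, hε, ?_⟩
  rwa [map_sub, imaginaryPart_eq_zero_iff.2 ha, sub_zero]

variable [PartialOrder M] [StarOrderedRing M] [PartialOrder N] [StarOrderedRing N]

theorem mem_upperHalfPlane_iff_isStrictlyPositive {T : M} :
    T ∈ upperHalfPlane M ↔ IsStrictlyPositive (ℑ T : M) := by
  simp only [upperHalfPlane, algebraMap_complex_ofReal, Set.mem_ofPred_eq]
  refine ⟨fun ⟨ε, hε, hle⟩ => (isStrictlyPositive_algebraMap hε).of_le hle, fun h => ?_⟩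
  rcases subsingleton_or_nontrivial M with _ | _
  · exact ⟨1, one_pos, (Subsingleton.elim _ _).le⟩
  · exact (CFC.exists_pos_algebraMap_le_iff (ℑ T).2).2 fun _ => h.spectrum_pos

theorem isUnit_of_mem_upperHalfPlane {T : M} (hT : T ∈ upperHalfPlane M) : IsUnit T := by
  obtain ⟨_, ⟨b, rfl⟩, hb, hbb⟩ :=
    CStarAlgebra.isStrictlyPositive_iff_exists_isUnit_and_isSelfAdjoint_and_eq_mul_self.1
      (mem_upperHalfPlane_iff_isStrictlyPositive.1 hT)
  have hb_inv : star (↑b⁻¹ : M) = ↑b⁻¹ := by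
    rw [← Units.coe_star, star_inv, show star b = b from Units.ext hb]
  have hsa : IsSelfAdjoint ((↑b⁻¹ : M) * (ℜ T : M) * ↑b⁻¹) := by
    simpa only [hb_inv] using (ℜ T).2.conjugate (↑b⁻¹ : M)
  have hfactor : T = b * ((↑b⁻¹ : M) * (ℜ T : M) * ↑b⁻¹ + algebraMap ℂ M Complex.I) * b := by
    conv_lhs => rw [← realPart_add_I_smul_imaginaryPart T, hbb]
    simp [mul_add, add_mul, mul_assoc, Algebra.algebraMap_eq_smul_one]
  rw [hfactor]
  exact (b.isUnit.mul (isUnit_add_I_of_isSelfAdjoint hsa)).mul b.isUnit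

theorem neg_inverse_mem_upperHalfPlane {T : M} (hT : T ∈ upperHalfPlane M) :
    -Ring.inverse T ∈ upperHalfPlane M := by
  obtain ⟨T, rfl⟩ := isUnit_of_mem_upperHalfPlane hT
  rw [mem_upperHalfPlane_iff_isStrictlyPositive] at hT ⊢
  rw [Ring.inverse_unit, imaginaryPart_neg_inv]
  exact (IsUnit.isStrictlyPositive_star_right_conjugate_iff T⁻¹.isUnit).2 hT

theorem isUnit_sub_of_mem_upperHalfPlane {a T : M} (ha : IsSelfAdjoint a)
    (hT : T ∈ upperHalfPlane M) : IsUnit (a - T) := by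
  rw [← neg_sub]
  exact (isUnit_of_mem_upperHalfPlane (sub_mem_upperHalfPlane hT ha)).neg

theorem inverse_sub_mem_upperHalfPlane {a T : M} (ha : IsSelfAdjoint a)
    (hT : T ∈ upperHalfPlane M) : Ring.inverse (a - T) ∈ upperHalfPlane M := by
  have h := sub_mem_upperHalfPlane hT ha
  obtain ⟨w, hw⟩ := isUnit_of_mem_upperHalfPlane h
  have hinv : Ring.inverse (a - T) = -Ring.inverse (T - a) := by
    rw [← neg_sub T a, ← hw, ← Units.val_neg, Ring.inverse_unit, Ring.inverse_unit, inv_neg,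
      Units.val_neg]
  exact hinv ▸ neg_inverse_mem_upperHalfPlane h

theorem isOpen_upperHalfPlane : IsOpen (upperHalfPlane M) := by
  refine Metric.isOpen_iff.2 fun T ⟨ε, hε, hle⟩ => ⟨ε / 2, half_pos hε, fun S hS => ?_⟩
  refine ⟨ε / 2, half_pos hε, ?_⟩
  have hnorm : ‖(ℑ (S - T) : M)‖ ≤ ε / 2 :=
    (imaginaryPart.norm_le (S - T)).trans (mem_ball_iff_norm.1 hS).le
  have hlow : -algebraMap ℝ M (ε / 2) ≤ (ℑ (S - T) : M) :=
    (neg_le_neg (algebraMap_mono M hnorm)).trans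
      (IsSelfAdjoint.neg_algebraMap_norm_le_self (ℑ (S - T)).2)
  calc algebraMap ℂ M ((ε / 2 : ℝ) : ℂ)
      = algebraMap ℂ M (ε : ℂ) + -algebraMap ℝ M (ε / 2) := by
        rw [algebraMap_complex_ofReal, algebraMap_complex_ofReal, ← map_neg, ← map_add]
        ring_nf
    _ ≤ (ℑ T : M) + (ℑ (S - T) : M) := add_le_add hle hlow
    _ = (ℑ S : M) := by simp

theorem map_mem_upperHalfPlane {F : Type*} [FunLike F M N] [LinearMapClass F ℂ M N]
    [OrderHomClass F M N] (φ : F) (hφ : φ 1 = 1) {T : M} (hT : T ∈ upperHalfPlane M) :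
    φ T ∈ upperHalfPlane N := by
  obtain ⟨ε, hε, hle⟩ := hT
  refine ⟨ε, hε, ?_⟩
  have := OrderHomClass.mono φ hle
  rwa [Algebra.algebraMap_eq_smul_one, map_smul, hφ, ← Algebra.algebraMap_eq_smul_one,
    map_imaginaryPart] at this

theorem mem_upperHalfPlane_of_map (φ : M →⋆ₐ[ℂ] N) (hφ : Function.Injective φ) {T : M}
    (hT : φ T ∈ upperHalfPlane N) : T ∈ upperHalfPlane M := by
  rw [mem_upperHalfPlane_iff_isStrictlyPositive,
    CStarAlgebra.isStrictlyPositive_iff_isSelfAdjoint_and_spectrum_pos] at hT ⊢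
  refine ⟨(ℑ T).2, ?_⟩
  rw [← IsSelfAdjoint.map_spectrum_real (ℑ T).2 φ hφ, map_imaginaryPart]
  exact hT.2

end UpperHalfPlane

/-! ## Twisted derivations -/

section TwistedDerivation

variable {R S T U : Type*} [Ring R] [Ring S] [Ring T] [Ring U]

/-- An additive map `D : R → T` satisfying the Leibniz rule, when `R` acts on `T` from the left
through `l` and from the right through `r`. -/
def IsTwistedDerivation (l r : R →+* T) (D : R →+ T) : Prop :=
  ∀ a b, D (a * b) = l a * D b + D a * r b

/-- `F = x - φ(u⁻¹)⁻¹`, the solution of the equation `φ(u⁻¹) = (x - F)⁻¹`. It is applied both to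
operators and to formal power series. -/
noncomputable def subordination (φ : R → S) (x : S) (u : R) : S :=
  x - Ring.inverse (φ (Ring.inverse u))

theorem map_ringInverse (f : R →+* T) {a : R} (ha : IsUnit a) :
    f (Ring.inverse a) = Ring.inverse (f a) := by
  obtain ⟨u, rfl⟩ := ha
  rw [Ring.inverse_unit]
  exact (Ring.inverse_unit (Units.map f.toMonoidHom u)).symm

theorem map_subordination {f : R →+* T} {g : S →+* U} {φ : R → S} {ψ : T → U}
    (h : ∀ a, g (φ a) = ψ (f a)) {x : S} {u : R} (hu : IsUnit u)
    (hφu : IsUnit (φ (Ring.inverse u))) :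
    g (subordination φ x u) = subordination ψ (g x) (f u) := by
  rw [subordination, subordination, map_sub, map_ringInverse g hφu, h, map_ringInverse f hu]

theorem sub_subordination (φ : R → S) (x : S) (u : R) :
    x - subordination φ x u = Ring.inverse (φ (Ring.inverse u)) :=
  sub_sub_cancel _ _

namespace IsTwistedDerivation

variable {l r : R →+* T} {D : R →+ T}

theorem map_one_eq_zero (hD : IsTwistedDerivation l r D) : D 1 = 0 := by
  simpa only [mul_one, map_one, one_mul, left_eq_add] using hD 1 1

theorem map_units_inv (hD : IsTwistedDerivation l r D) (u : Rˣ) :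
    D (↑u⁻¹ : R) = -(l (↑u⁻¹ : R) * D u * r (↑u⁻¹ : R)) := by
  have hsum : l (↑u⁻¹ : R) * D u + D (↑u⁻¹ : R) * r u = 0 := by
    rw [← hD, u.inv_mul, hD.map_one_eq_zero]
  rw [eq_neg_of_add_eq_zero_left hsum, neg_mul, neg_neg, mul_assoc, ← map_mul, u.mul_inv,
    map_one, mul_one]

theorem comp_ringHom (hD : IsTwistedDerivation l r D) (f : T →+* U) :
    IsTwistedDerivation (f.comp l) (f.comp r) (f.toAddMonoidHom.comp D) := fun a b => by
  simpa using congrArg f (hD a b)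

theorem mapMatrix {ι : Type*} [Fintype ι] [DecidableEq ι] (hD : IsTwistedDerivation l r D) :
    IsTwistedDerivation (l.mapMatrix (m := ι)) r.mapMatrix D.mapMatrix := fun M N => by
  ext i j
  simp [Matrix.mul_apply, hD _ _, Finset.sum_add_distrib]

theorem map_subordination_eq_zero {l' r' : S →+* U} {D' : S →+ U}
    (hD : IsTwistedDerivation l r D) (hD' : IsTwistedDerivation l' r' D') {φ : R → S}
    {θ : T →+ U} {x : S} {u : R} (hθ_comm : ∀ a, θ (D a) = D' (φ a))
    (hθ_mul : ∀ a b, θ (l a * D u * r b) = l' (φ a) * D' x * r' (φ b)) (hu : IsUnit u)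
    (hφu : IsUnit (φ (Ring.inverse u))) : D' (subordination φ x u) = 0 := by
  obtain ⟨u, rfl⟩ := hu
  obtain ⟨v, hv⟩ := hφu
  rw [Ring.inverse_unit] at hv
  have hDv : D' v = -(l' v * D' x * r' v) := by
    rw [hv, ← hθ_comm, hD.map_units_inv, map_neg, hθ_mul]
  rw [subordination, Ring.inverse_unit, ← hv, Ring.inverse_unit, map_sub, hD'.map_units_inv, hDv,
    mul_neg, neg_mul, neg_neg, ← mul_assoc, ← mul_assoc, ← map_mul, v.inv_mul, map_one,
    one_mul, mul_assoc, ← map_mul, v.mul_inv, map_one, mul_one, sub_self]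

end IsTwistedDerivation

theorem eq_of_isTwistedDerivation_of_adjoin_eq_top {k : Type*} [CommRing k] [Algebra k R]
    [Algebra k T] {l r : R →+* T} {D E : R →ₗ[k] T}
    (hD : IsTwistedDerivation l r D.toAddMonoidHom)
    (hE : IsTwistedDerivation l r E.toAddMonoidHom) {s : Set R}
    (hs : Algebra.adjoin k s = ⊤) (h : Set.EqOn D E s) : D = E := by
  ext p
  have hp : p ∈ Algebra.adjoin k s := hs ▸ Algebra.mem_top
  induction hp using Algebra.adjoin_induction with
  | mem p hp => exact h hp
  | algebraMap c =>
    rw [Algebra.algebraMap_eq_smul_one, map_smul, map_smul, show D 1 = 0 from hD.map_one_eq_zero,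
      show E 1 = 0 from hE.map_one_eq_zero]
  | add p q _ _ hp hq => rw [map_add, map_add, hp, hq]
  | mul p q _ _ hp hq =>
    rw [show D (p * q) = l p * D q + D p * r q from hD p q,
      show E (p * q) = l p * E q + E p * r q from hE p q, hp, hq]

theorem mapMatrix_mul_mapMatrix {ι : Type*} [Fintype ι] [DecidableEq ι] {l r : R →+* T}
    {l' r' : S →+* U} {φ : R →+ S} {θ : T →+ U}
    (hθ : ∀ a b, θ (l a * r b) = l' (φ a) * r' (φ b)) (M N : Matrix ι ι R) :
    θ.mapMatrix (l.mapMatrix M * r.mapMatrix N) =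
      l'.mapMatrix (φ.mapMatrix M) * r'.mapMatrix (φ.mapMatrix N) := by
  ext i j
  simp [Matrix.mul_apply, hθ]

end TwistedDerivation

/-! ## Formal power series with noncommutative coefficients -/

section CoeffMap

open PowerSeries

variable {R S T U : Type*} [Ring R] [Ring S] [Ring T] [Ring U]

/-- The additive map of power series that applies an additive map to each coefficient; for a ring
homomorphism this is `PowerSeries.map`. -/
noncomputable def coeffMap (D : R →+ T) : PowerSeries R →+ PowerSeries T where
  toFun p := mk fun k => D (coeff k p)
  map_zero' := by ext; simp
  map_add' p q := by ext; simp

@[simp]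
theorem coeff_coeffMap (D : R →+ T) (p : PowerSeries R) (k : ℕ) :
    coeff k (coeffMap D p) = D (coeff k p) := by
  simp [coeffMap]

theorem coeffMap_C (D : R →+ T) (a : R) : coeffMap D (C a) = C (D a) := by
  ext k
  rw [coeff_coeffMap, coeff_C, coeff_C, apply_ite D, map_zero]

theorem coeffMap_X_mul (D : R →+ T) (p : PowerSeries R) :
    coeffMap D (X * p) = X * coeffMap D p := by
  ext k
  cases k <;> simp [coeff_succ_X_mul]

theorem IsTwistedDerivation.coeffMap {l r : R →+* T} {D : R →+ T}
    (hD : IsTwistedDerivation l r D) :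
    IsTwistedDerivation (map l) (map r) (coeffMap D) := fun p q => by
  ext k
  simp [coeff_mul, hD _ _, Finset.sum_add_distrib]

theorem coeffMap_X_mul_C_sub_C {D : R →+ T} {a b : R} (ha : D a = 1) (hb : D b = 0) :
    coeffMap D (X * C a - C b) = X := by
  rw [map_sub, coeffMap_X_mul, coeffMap_C, coeffMap_C, ha, hb, map_one, mul_one, map_zero,
    sub_zero]

theorem coeffMap_mul_X_mul {l r : R →+* T} {l' r' : S →+* U} {φ : R →+ S} {θ : T →+ U}
    (hθ : ∀ a b, θ (l a * r b) = l' (φ a) * r' (φ b)) (p q : PowerSeries R) :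
    coeffMap θ (map l p * X * map r q) =
      map l' (coeffMap φ p) * X * map r' (coeffMap φ q) := by
  have hmul : coeffMap θ (map l p * map r q) =
      map l' (coeffMap φ p) * map r' (coeffMap φ q) := by
    ext k
    simp [coeff_mul, hθ]
  rw [(commute_X _).eq, mul_assoc, coeffMap_X_mul, hmul, ← mul_assoc, ← (commute_X _).eq]

theorem isUnit_X_mul_C_sub_C (a : R) {b : R} (hb : IsUnit b) : IsUnit (X * C a - C b) := by
  rw [isUnit_iff_constantCoeff]
  simpa using hb

theorem isUnit_coeffMap_inverse_X_mul_C_sub_C {φ : R →+ S} {a b : R} (hb : IsUnit b)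
    (hφb : IsUnit (φ (Ring.inverse (-b)))) :
    IsUnit (coeffMap φ (Ring.inverse (X * C a - C b))) := by
  have hconst : constantCoeff (Ring.inverse (X * C a - C b)) = Ring.inverse (-b) := by
    rw [map_ringInverse _ (isUnit_X_mul_C_sub_C a hb)]
    simp
  rwa [isUnit_iff_constantCoeff, ← coeff_zero_eq_constantCoeff_apply, coeff_coeffMap,
    coeff_zero_eq_constantCoeff_apply, hconst]

theorem map_coeff_subordination_eq_zero {l r : R →+* T} {D : R →+ T}
    (hD : IsTwistedDerivation l r D) {l' r' : S →+* U} {D' : S →+ U}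
    (hD' : IsTwistedDerivation l' r' D') {φ : R →+ S} {θ : T →+ U}
    (hθ_comm : ∀ a, θ (D a) = D' (φ a)) (hθ_mul : ∀ a b, θ (l a * r b) = l' (φ a) * r' (φ b))
    {y b : R} {x : S} (hy : D y = 1) (hb : D b = 0) (hx : D' x = 1) (hu : IsUnit (X * C y - C b))
    (hφu : IsUnit (coeffMap φ (Ring.inverse (X * C y - C b)))) (k : ℕ) :
    D' (coeff k (subordination (coeffMap φ) (X * C x) (X * C y - C b))) = 0 := by
  have hDu : coeffMap D (X * C y - C b) = X := coeffMap_X_mul_C_sub_C hy hb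
  have hDx : coeffMap D' (X * C x) = X := by
    rw [coeffMap_X_mul, coeffMap_C, hx, map_one, mul_one]
  have hzero : coeffMap D' (subordination (coeffMap φ) (X * C x) (X * C y - C b)) = 0 := by
    refine hD.coeffMap.map_subordination_eq_zero hD'.coeffMap (θ := coeffMap θ) (fun p => ?_)
      (fun p q => ?_) hu hφu
    · ext k
      simp [hθ_comm]
    · rw [hDu, hDx, coeffMap_mul_X_mul hθ_mul]
  rw [← coeff_coeffMap, hzero, map_zero]

end CoeffMap

/-! ## The kernel of the free difference quotient -/

section Kernel

variable {K : Type u} [CStarAlgebra K] {A : StarSubalgebra ℂ K} {X : K}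

/-- The homomorphism `ε : A⟨X⟩ → A` that is the identity on `A` and kills `X`. -/
noncomputable def polyAugmentation (h : AlgebraicallyFree A X) : polyAlgebra A X →ₐ[ℂ] A :=
  (NCPolynomial.lift (AlgHom.id ℂ A) 0).comp (polyEquiv h).symm.toAlgHom

theorem polyAugmentation_coeff (h : AlgebraicallyFree A X) (a : A) :
    polyAugmentation h (polyCoeff A X a) = a := by
  simp [polyAugmentation, ← polyEquiv_const h]

theorem polyAugmentation_gen (h : AlgebraicallyFree A X) :
    polyAugmentation h (polyGen A X) = 0 := by
  simp [polyAugmentation, ← polyEquiv_var h]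

/-- The contraction `x ⊗ y ↦ x X ε(y)`, with which `p - ε(p)` is recovered from `∂ p`. -/
noncomputable def polyContract (h : AlgebraicallyFree A X) :
    polyAlgebra A X ⊗[ℂ] polyAlgebra A X →ₗ[ℂ] polyAlgebra A X :=
  TensorProduct.lift ((LinearMap.mul ℂ (polyAlgebra A X)).compl₁₂
    (LinearMap.mulRight ℂ (polyGen A X))
    ((polyCoeff A X).toLinearMap ∘ₗ (polyAugmentation h).toLinearMap))

theorem polyContract_tmul (h : AlgebraicallyFree A X) (x y : polyAlgebra A X) :
    polyContract h (x ⊗ₜ y) = x * polyGen A X * polyCoeff A X (polyAugmentation h y) := rfl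

theorem polyContract_tmul_one_mul (h : AlgebraicallyFree A X) (p : polyAlgebra A X)
    (z : polyAlgebra A X ⊗[ℂ] polyAlgebra A X) :
    polyContract h ((p ⊗ₜ 1) * z) = p * polyContract h z := by
  induction z using TensorProduct.induction_on with
  | zero => simp
  | tmul x y => simp [polyContract_tmul, mul_assoc]
  | add x y hx hy => simp [mul_add, hx, hy]

theorem polyContract_mul_one_tmul (h : AlgebraicallyFree A X) (q : polyAlgebra A X)
    (z : polyAlgebra A X ⊗[ℂ] polyAlgebra A X) :
    polyContract h (z * (1 ⊗ₜ q)) = polyContract h z * polyCoeff A X (polyAugmentation h q) := by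
  induction z using TensorProduct.induction_on with
  | zero => simp
  | tmul x y => simp [polyContract_tmul, mul_assoc]
  | add x y hx hy => simp [add_mul, hx, hy]

theorem polyContract_freeDifferenceQuotient (h : AlgebraicallyFree A X) (p : polyAlgebra A X) :
    polyContract h (freeDifferenceQuotient h p) = p - polyCoeff A X (polyAugmentation h p) := by
  let ε := (polyCoeff A X).comp (polyAugmentation h)
  have hcontract : IsTwistedDerivation (RingHom.id _) (ε : polyAlgebra A X →+* polyAlgebra A X)
      (polyContract h ∘ₗ freeDifferenceQuotient h).toAddMonoidHom := fun p q => by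
    change polyContract h (freeDifferenceQuotient h (p * q)) = _
    rw [freeDifferenceQuotient_mul, map_add, polyContract_tmul_one_mul, polyContract_mul_one_tmul]
    rfl
  have hsub : IsTwistedDerivation (RingHom.id _) (ε : polyAlgebra A X →+* polyAlgebra A X)
      (LinearMap.id - ε.toLinearMap).toAddMonoidHom := fun p q => by
    change p * q - ε (p * q) = p * (q - ε q) + (p - ε p) * ε q
    rw [map_mul]
    noncomm_ring
  refine LinearMap.congr_fun (eq_of_isTwistedDerivation_of_adjoin_eq_top hcontract hsub
    Algebra.adjoin_adjoin_coe_preimage ?_) p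
  rintro p (hp | hp)
  · rw [show p = polyCoeff A X ⟨p, hp⟩ from rfl]
    simp [ε, freeDifferenceQuotient_coeff, polyAugmentation_coeff]
  · rw [show p = polyGen A X from Subtype.ext hp]
    simp [ε, freeDifferenceQuotient_gen, polyAugmentation_gen, polyContract_tmul]

theorem freeDifferenceQuotientIn_eq_zero_iff (h : AlgebraicallyFree A X) (p : polyAlgebra A X) :
    freeDifferenceQuotientIn h p = 0 ↔ (p : K) ∈ A := by
  constructor
  · intro hp
    have hp₀ : freeDifferenceQuotient h p = 0 :=
      TensorProduct.map_injective_of_flat_flat _ _ Subtype.val_injective Subtype.val_injective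
        (hp.trans (map_zero _).symm)
    have hε := polyContract_freeDifferenceQuotient h p
    rw [hp₀, map_zero, eq_comm, sub_eq_zero] at hε
    exact hε ▸ (polyAugmentation h p).2
  · intro hp
    rw [show p = polyCoeff A X ⟨p, hp⟩ from rfl, freeDifferenceQuotientIn, LinearMap.comp_apply,
      freeDifferenceQuotient_coeff, map_zero]

theorem freeDifferenceQuotientIn_gen (h : AlgebraicallyFree A X) :
    freeDifferenceQuotientIn h (polyGen A X) = 1 := by
  rw [freeDifferenceQuotientIn, LinearMap.comp_apply, freeDifferenceQuotient_gen]
  rfl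

theorem isTwistedDerivation_freeDifferenceQuotientIn (h : AlgebraicallyFree A X) :
    IsTwistedDerivation
      ((Algebra.TensorProduct.includeLeftRingHom : K →+* K ⊗[ℂ] K).comp
        (polyAlgebra A X).val.toRingHom)
      ((Algebra.TensorProduct.includeRight : K →ₐ[ℂ] K ⊗[ℂ] K).toRingHom.comp
        (polyAlgebra A X).val.toRingHom)
      (freeDifferenceQuotientIn h).toAddMonoidHom := by
  have hD : IsTwistedDerivation
      (Algebra.TensorProduct.includeLeftRingHom : polyAlgebra A X →+* _)
      (Algebra.TensorProduct.includeRight : polyAlgebra A X →ₐ[ℂ] _).toRingHom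
      (freeDifferenceQuotient h).toAddMonoidHom := freeDifferenceQuotient_mul h
  convert hD.comp_ringHom
    (Algebra.TensorProduct.map (polyAlgebra A X).val (polyAlgebra A X).val).toRingHom using 1
  · ext p; simp
  · ext p; simp
  · rfl

end Kernel

/-! ## Taylor series of functions with values in a Banach algebra -/

section Analytic

variable {𝕜 E M N F G : Type*} [NontriviallyNormedField 𝕜] [NormedAddCommGroup E]
  [NormedSpace 𝕜 E] [NormedRing M] [NormedAlgebra 𝕜 M] [CompleteSpace M] [NormedRing N]
  [NormedAlgebra 𝕜 N] [CompleteSpace N] [NormedAddCommGroup F] [NormedSpace 𝕜 F]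
  [NormedAddCommGroup G] [NormedSpace 𝕜 G]

theorem analyticAt_ringInverse {f : E → M} {e : E} (hf : AnalyticAt 𝕜 f e) (hu : IsUnit (f e)) :
    AnalyticAt 𝕜 (fun z => Ring.inverse (f z)) e :=
  AnalyticAt.fun_comp (analyticOnNhd_inverse (f e) hu) hf

theorem analyticAt_subordination {u : E → M} {x : E → N} (Φ : M →L[𝕜] N) {e : E}
    (hu : AnalyticAt 𝕜 u e) (hx : AnalyticAt 𝕜 x e) (hu_unit : IsUnit (u e))
    (hΦu : IsUnit (Φ (Ring.inverse (u e)))) :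
    AnalyticAt 𝕜 (fun z => subordination Φ (x z) (u z)) e :=
  hx.sub (analyticAt_ringInverse
    ((Φ.analyticAt _).fun_comp (analyticAt_ringInverse hu hu_unit)) hΦu)

theorem iteratedDeriv_clm_comp {f : 𝕜 → F} {z : 𝕜} {k : ℕ} (Φ : F →L[𝕜] G)
    (hf : ContDiffAt 𝕜 k f z) :
    iteratedDeriv k (fun z => Φ (f z)) z = Φ (iteratedDeriv k f z) :=
  congrArg (· fun _ => 1) (Φ.iteratedFDeriv_comp_left hf le_rfl)

end Analytic

section TaylorSeries

open PowerSeries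

variable {𝕜 M N : Type*} [NontriviallyNormedField 𝕜] [NormedRing M] [NormedAlgebra 𝕜 M]
  [NormedRing N] [NormedAlgebra 𝕜 N]

/-- The formal Taylor series at `0` of an `M`-valued function of one variable. -/
noncomputable def taylorSeries (f : 𝕜 → M) : PowerSeries M :=
  mk fun k => (k.factorial : 𝕜)⁻¹ • iteratedDeriv k f 0

theorem coeff_taylorSeries (f : 𝕜 → M) (k : ℕ) :
    coeff k (taylorSeries f) = (k.factorial : 𝕜)⁻¹ • iteratedDeriv k f 0 :=
  coeff_mk _ _

theorem taylorSeries_const (a : M) : taylorSeries (fun _ : 𝕜 => a) = C a := by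
  ext k
  rw [coeff_taylorSeries, iteratedDeriv_const, coeff_C]
  split_ifs with hk <;> simp [hk]

theorem taylorSeries_smul_const (a : M) : taylorSeries (fun z : 𝕜 => z • a) = X * C a := by
  ext k
  rw [coeff_taylorSeries, iteratedDeriv_smul_const contDiffAt_fun_id, iteratedDeriv_fun_id]
  rcases k with _ | _ | k <;> simp [coeff_X]

theorem taylorSeries_congr {f g : 𝕜 → M} (h : f =ᶠ[nhds 0] g) :
    taylorSeries f = taylorSeries g := by
  ext k
  rw [coeff_taylorSeries, coeff_taylorSeries, h.iteratedDeriv_eq]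

variable [CompleteSpace M]

theorem taylorSeries_sub {f g : 𝕜 → M} (hf : AnalyticAt 𝕜 f 0) (hg : AnalyticAt 𝕜 g 0) :
    taylorSeries (fun z => f z - g z) = taylorSeries f - taylorSeries g := by
  ext k
  simp only [map_sub, coeff_taylorSeries, ← smul_sub,
    iteratedDeriv_fun_sub hf.contDiffAt hg.contDiffAt]

theorem taylorSeries_clm_comp {f : 𝕜 → M} (hf : AnalyticAt 𝕜 f 0) (Φ : M →L[𝕜] N) :
    taylorSeries (fun z => Φ (f z)) = coeffMap (Φ : M →+ N) (taylorSeries f) := by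
  ext k
  rw [coeff_taylorSeries, iteratedDeriv_clm_comp Φ hf.contDiffAt, coeff_coeffMap,
    coeff_taylorSeries]
  exact (map_smul Φ _ _).symm

variable [CharZero 𝕜]

theorem taylorSeries_mul {f g : 𝕜 → M} (hf : AnalyticAt 𝕜 f 0) (hg : AnalyticAt 𝕜 g 0) :
    taylorSeries (fun z => f z * g z) = taylorSeries f * taylorSeries g := by
  ext k
  rw [coeff_taylorSeries, iteratedDeriv_fun_mul hf.contDiffAt hg.contDiffAt, coeff_mul,
    Finset.Nat.sum_antidiagonal_eq_sum_range_succ_mk, Finset.smul_sum]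
  refine Finset.sum_congr rfl fun i hi => ?_
  have hik : i ≤ k := Finset.mem_range_succ_iff.1 hi
  have hchoose : (k.factorial : 𝕜)⁻¹ * k.choose i =
      (i.factorial : 𝕜)⁻¹ * ((k - i).factorial : 𝕜)⁻¹ := by
    rw [Nat.cast_choose 𝕜 hik]
    have := Nat.cast_ne_zero (R := 𝕜).2 k.factorial_ne_zero
    field_simp
  rw [coeff_taylorSeries, coeff_taylorSeries, smul_mul_smul_comm, ← hchoose, mul_smul, mul_assoc,
    ← nsmul_eq_mul, Nat.cast_smul_eq_nsmul]

theorem taylorSeries_inverse {f : 𝕜 → M} (hf : AnalyticAt 𝕜 f 0) (hu : IsUnit (f 0)) :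
    taylorSeries (fun z => Ring.inverse (f z)) = Ring.inverse (taylorSeries f) := by
  have hinv := analyticAt_ringInverse hf hu
  have hev : ∀ᶠ z in nhds 0, IsUnit (f z) :=
    hf.continuousAt.eventually (Units.isOpen.eventually_mem hu)
  have hl : taylorSeries (fun z => Ring.inverse (f z)) * taylorSeries f = 1 := by
    rw [← taylorSeries_mul hinv hf, taylorSeries_congr (g := fun _ => 1), taylorSeries_const,
      map_one]
    exact hev.mono fun z hz => Ring.inverse_mul_cancel _ hz
  have hr : taylorSeries f * taylorSeries (fun z => Ring.inverse (f z)) = 1 := by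
    rw [← taylorSeries_mul hf hinv, taylorSeries_congr (g := fun _ => 1), taylorSeries_const,
      map_one]
    exact hev.mono fun z hz => Ring.mul_inverse_cancel _ hz
  exact (Ring.inverse_unit ⟨_, _, hr, hl⟩).symm

variable [CompleteSpace N]

theorem taylorSeries_subordination {u : 𝕜 → M} {x : 𝕜 → N} (Φ : M →L[𝕜] N)
    (hu : AnalyticAt 𝕜 u 0) (hx : AnalyticAt 𝕜 x 0) (hu_unit : IsUnit (u 0))
    (hΦu : IsUnit (Φ (Ring.inverse (u 0)))) :
    taylorSeries (fun z => subordination Φ (x z) (u z)) =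
      subordination (coeffMap (Φ : M →+ N)) (taylorSeries x) (taylorSeries u) := by
  have hinv : AnalyticAt 𝕜 (fun z => Ring.inverse (u z)) 0 :=
    analyticAt_ringInverse hu hu_unit
  have hΦinv : AnalyticAt 𝕜 (fun z => Φ (Ring.inverse (u z))) 0 :=
    (Φ.analyticAt _).fun_comp hinv
  unfold subordination
  rw [taylorSeries_sub hx (analyticAt_ringInverse hΦinv hΦu),
    taylorSeries_inverse hΦinv hΦu, taylorSeries_clm_comp hinv, taylorSeries_inverse hu hu_unit]

theorem mem_of_coeff_taylorSeries_mem {M : Type*} [NormedRing M] [NormedAlgebra ℝ M]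
    [CompleteSpace M] {f : ℝ → M} (hf : AnalyticOnNhd ℝ f Set.univ) {Q : Submodule ℝ M}
    (hQ : IsClosed (Q : Set M)) (h : ∀ k, coeff k (taylorSeries f) ∈ Q) (z : ℝ) : f z ∈ Q := by
  have hf₀ : AnalyticAt ℝ f 0 := hf 0 (Set.mem_univ 0)
  have hπf : AnalyticOnNhd ℝ (fun z => Q.mkQL (f z)) Set.univ := fun z hz =>
    (Q.mkQL.analyticAt _).fun_comp (hf z hz)
  have hderiv : ∀ k, iteratedDeriv k (fun z => Q.mkQL (f z)) 0 = 0 := fun k => by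
    have hk := h k
    rw [coeff_taylorSeries,
      Q.smul_mem_iff (inv_ne_zero (Nat.cast_ne_zero.2 k.factorial_ne_zero))] at hk
    rw [iteratedDeriv_clm_comp Q.mkQL hf₀.contDiffAt]
    exact (Submodule.Quotient.mk_eq_zero Q).2 hk
  have horder : analyticOrderAt (fun z => Q.mkQL (f z)) 0 = ⊤ :=
    ENat.eq_top_iff_forall_ge.2 fun n =>
      (natCast_le_analyticOrderAt_iff_iteratedDeriv_eq_zero (hπf 0 (Set.mem_univ 0))).2
        fun k _ => hderiv k
  have hzero : (fun z => Q.mkQL (f z)) = fun _ => 0 :=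
    hπf.eq_of_eventuallyEq (fun _ _ => analyticAt_const) (analyticOrderAt_eq_top.1 horder)
  simpa using congrFun hzero z

theorem subordination_mem_of_coeff_mem {R S M N : Type*} [Ring R] [Ring S] [NormedRing M]
    [NormedAlgebra ℝ M] [CompleteSpace M] [NormedRing N] [NormedAlgebra ℝ N] [CompleteSpace N]
    {f : R →+* M} {g : S →+* N} {φ : R →+ S} {Φ : M →L[ℝ] N} (hΦ : ∀ a, g (φ a) = Φ (f a))
    {y b : R} {x : S} (hu : IsUnit (X * C y - C b))
    (hφu : IsUnit (coeffMap φ (Ring.inverse (X * C y - C b))))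
    (hu_real : ∀ z : ℝ, IsUnit (z • f y - f b))
    (hΦu_real : ∀ z : ℝ, IsUnit (Φ (Ring.inverse (z • f y - f b))))
    {Q : Submodule ℝ N} (hQ : IsClosed (Q : Set N))
    (hmem : ∀ k, g (coeff k (subordination (coeffMap φ) (X * C x) (X * C y - C b))) ∈ Q) :
    subordination Φ (g x) (f y - f b) ∈ Q := by
  have hlin : ∀ z, AnalyticAt ℝ (fun z : ℝ => z • f y - f b) z := fun z =>
    (analyticAt_id.smul analyticAt_const).sub analyticAt_const
  have hsmul : ∀ z, AnalyticAt ℝ (fun z : ℝ => z • g x) z := fun z =>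
    analyticAt_id.smul analyticAt_const
  have han : AnalyticOnNhd ℝ (fun z : ℝ => subordination Φ (z • g x) (z • f y - f b))
      Set.univ := fun z _ =>
    analyticAt_subordination Φ (hlin z) (hsmul z) (hu_real z) (hΦu_real z)
  have htaylor : taylorSeries (fun z : ℝ => subordination Φ (z • g x) (z • f y - f b)) =
      map g (subordination (coeffMap φ) (X * C x) (X * C y - C b)) := by
    rw [taylorSeries_subordination Φ (hlin 0) (hsmul 0) (hu_real 0) (hΦu_real 0),
      map_subordination (f := map f) (ψ := coeffMap (Φ : M →+ N)) _ hu hφu]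
    · rw [taylorSeries_smul_const, taylorSeries_sub _ analyticAt_const, taylorSeries_smul_const,
        taylorSeries_const]
      · simp
      · exact analyticAt_id.smul analyticAt_const
    · intro p
      ext k
      simp [hΦ]
  have hcoeff : ∀ k, coeff k
      (taylorSeries fun z : ℝ => subordination Φ (z • g x) (z • f y - f b)) ∈ Q := fun k => by
    rw [htaylor, coeff_map]
    exact hmem k
  simpa only [one_smul] using mem_of_coeff_taylorSeries_mem han hQ hcoeff 1

end TaylorSeries

/-! ## Subordination functions of unital positive maps -/

section Differentiability

variable {𝕜 E F G : Type*} [NontriviallyNormedField 𝕜] [NormedAddCommGroup E] [NormedSpace 𝕜 E]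
  [NormedAddCommGroup F] [NormedSpace 𝕜 F] [NormedAddCommGroup G] [NormedSpace 𝕜 G]

theorem fderiv_apply_mem_of_forall_mem {f : E → F} {D : E →L[𝕜] F} {e : E}
    (hf : HasFDerivAt f D e) {Q : Submodule 𝕜 F} (hQ : IsClosed (Q : Set F))
    (hmem : ∀ z, f z ∈ Q) (v : E) : D v ∈ Q := by
  have hπf : HasFDerivAt (fun z => Q.mkQL (f z)) (Q.mkQL ∘L D) e :=
    Q.mkQL.hasFDerivAt.comp e hf
  have hzero : (fun z => Q.mkQL (f z)) = fun _ => 0 :=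
    funext fun z => (Submodule.Quotient.mk_eq_zero Q).2 (hmem z)
  rw [hzero] at hπf
  exact (Submodule.Quotient.mk_eq_zero Q).1
    (congrArg (fun T => T v) (hπf.unique (hasFDerivAt_const 0 e)))

theorem differentiableAt_of_linearIsometry_comp (ι : F →ₗᵢ[𝕜] G) (hι : IsClosed (Set.range ι))
    {f : E → F} {e : E} (hf : DifferentiableAt 𝕜 (fun z => ι (f z)) e) :
    DifferentiableAt 𝕜 f e := by
  obtain ⟨D, hD⟩ := hf
  have hmem : ∀ v, D v ∈ ι.range := fderiv_apply_mem_of_forall_mem hD hι fun z => ⟨f z, rfl⟩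
  let D' : E →L[𝕜] F :=
    (ι.equivRange.symm : ι.range →L[𝕜] F) ∘L D.codRestrict ι.range hmem
  have hD' : ∀ v, ι (D' v) = D v := fun v =>
    congrArg Subtype.val (ι.equivRange.apply_symm_apply ⟨D v, hmem v⟩)
  refine ⟨D', ?_⟩
  rw [hasFDerivAt_iff_isLittleO, ← Asymptotics.isLittleO_norm_left] at hD ⊢
  simpa only [← hD', ← map_sub, ι.norm_map] using hD

end Differentiability

section PositiveMap

variable {M N : Type*} [CStarAlgebra M] [PartialOrder M] [StarOrderedRing M] [CStarAlgebra N]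
  [PartialOrder N] [StarOrderedRing N] {Φ : M →ₚ[ℂ] N} {a : M} {x : N}

theorem isUnit_map_inverse_sub (hΦ : Φ 1 = 1) (ha : IsSelfAdjoint a) {T : M}
    (hT : T ∈ upperHalfPlane M) : IsUnit (Φ (Ring.inverse (a - T))) :=
  isUnit_of_mem_upperHalfPlane
    (map_mem_upperHalfPlane Φ hΦ (inverse_sub_mem_upperHalfPlane ha hT))

theorem subordination_mem_upperHalfPlane (hΦ : Φ 1 = 1) (ha : IsSelfAdjoint a)
    (hx : IsSelfAdjoint x) {T : M} (hT : T ∈ upperHalfPlane M) :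
    subordination Φ x (a - T) ∈ upperHalfPlane N := by
  have hinv := neg_inverse_mem_upperHalfPlane
    (map_mem_upperHalfPlane Φ hΦ (inverse_sub_mem_upperHalfPlane ha hT))
  simpa only [subordination, sub_neg_eq_add, neg_add_eq_sub] using
    sub_mem_upperHalfPlane hinv hx.neg

theorem differentiableAt_subordination {E : Type*} [NormedAddCommGroup E] [NormedSpace ℂ E]
    (hΦ : Φ 1 = 1) (ha : IsSelfAdjoint a) (x : N) {ι : E →L[ℂ] M} {e : E}
    (he : ι e ∈ upperHalfPlane M) :
    DifferentiableAt ℂ (fun z => subordination Φ x (a - ι z)) e :=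
  (analyticAt_subordination (⟨Φ.toLinearMap, map_continuous Φ⟩ : M →L[ℂ] N)
    (analyticAt_const.sub (ι.analyticAt e)) analyticAt_const
    (isUnit_sub_of_mem_upperHalfPlane ha he) (isUnit_map_inverse_sub hΦ ha he)).differentiableAt

end PositiveMap

/-! ## Matrices over C⋆-algebras -/

section MatrixMaps

variable {K : Type u} {L : Type v} [CStarAlgebra K] [CStarAlgebra L]

/-- The inclusion `M_n(A) → M_n(K)`. -/
def cstarMatrixIncl (n : ℕ) (A : StarSubalgebra ℂ K) :
    CStarMatrix (Fin n) (Fin n) A →⋆ₐ[ℂ] CStarMatrix (Fin n) (Fin n) K where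
  toFun M := M.map Subtype.val
  map_one' := by
    ext i j
    by_cases h : i = j <;> simp [CStarMatrix.one_apply, h]
  map_mul' M N := by
    ext i j
    simp [CStarMatrix.mul_apply]
  map_zero' := by ext; simp
  map_add' M N := by ext; simp
  commutes' r := by
    ext i j
    by_cases h : i = j <;> simp [CStarMatrix.algebraMap_apply, h]
  map_star' M := by ext; simp [CStarMatrix.star_apply]

theorem cstarMatrixIncl_injective (n : ℕ) (A : StarSubalgebra ℂ K) :
    Function.Injective (cstarMatrixIncl n A) :=
  CStarMatrix.map_injective Subtype.val_injective

theorem exists_cstarMatrixIncl_eq {n : ℕ} {A : StarSubalgebra ℂ K}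
    {M : CStarMatrix (Fin n) (Fin n) K} (hM : ∀ i j, M i j ∈ A) : ∃ a, cstarMatrixIncl n A a = M :=
  ⟨CStarMatrix.ofMatrix fun i j => ⟨M i j, hM i j⟩, rfl⟩

theorem isSelfAdjoint_tensorOne {X : K} (hX : IsSelfAdjoint X) (n : ℕ) :
    IsSelfAdjoint (tensorOne X n) := by
  change (Matrix.diagonal fun _ => X).conjTranspose = Matrix.diagonal fun _ => X
  rw [Matrix.diagonal_conjTranspose]
  exact congrArg Matrix.diagonal (funext fun _ => hX.star_eq)

/-- The inclusion `M_n(A⟨X⟩) → M_n(K)`. -/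
def polyMatrixVal (n : ℕ) (A : StarSubalgebra ℂ K) (X : K) :
    Matrix (Fin n) (Fin n) (polyAlgebra A X) →+* CStarMatrix (Fin n) (Fin n) K :=
  (CStarMatrix.ofMatrixRingEquiv : Matrix (Fin n) (Fin n) K ≃+* _).toRingHom.comp
    (polyAlgebra A X).val.toRingHom.mapMatrix

theorem polyMatrixVal_diagonal_polyGen (n : ℕ) (A : StarSubalgebra ℂ K) (X : K) :
    polyMatrixVal n A X (Matrix.diagonal fun _ => polyGen A X) = tensorOne X n :=
  Matrix.diagonal_map (f := (polyAlgebra A X).val) (map_zero _)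

/-- The inclusion `M_n(A) → M_n(A⟨X⟩)`. -/
def polyMatrixCoeff (n : ℕ) (A : StarSubalgebra ℂ K) (X : K) :
    CStarMatrix (Fin n) (Fin n) A →+* Matrix (Fin n) (Fin n) (polyAlgebra A X) :=
  (polyCoeff A X).toRingHom.mapMatrix.comp
    (CStarMatrix.ofMatrixRingEquiv : Matrix (Fin n) (Fin n) A ≃+* _).symm.toRingHom

variable [PartialOrder K] [StarOrderedRing K] [PartialOrder L] [StarOrderedRing L]

/-- The inclusion `M_n(A) → M_n(K)` as an isometry. -/
noncomputable def cstarMatrixInclₗᵢ (n : ℕ) (A : StarSubalgebra ℂ K) [IsClosed (A : Set K)] :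
    CStarMatrix (Fin n) (Fin n) A →ₗᵢ[ℂ] CStarMatrix (Fin n) (Fin n) K where
  toLinearMap := (cstarMatrixIncl n A).toAlgHom.toLinearMap
  norm_map' M := NonUnitalStarAlgHom.norm_map (cstarMatrixIncl n A)
    (cstarMatrixIncl_injective n A) M

theorem isClosed_range_cstarMatrixInclₗᵢ (n : ℕ) (A : StarSubalgebra ℂ K)
    [IsClosed (A : Set K)] : IsClosed (Set.range (cstarMatrixInclₗᵢ n A)) :=
  (cstarMatrixInclₗᵢ n A).isometry.isClosedEmbedding.isClosed_range

/-- An `n`-positive linear map `Ψ`, applied entrywise: the positive map `M_n(Ψ)`. -/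
noncomputable def cstarMatrixMap {n : ℕ} (Ψ : L →ₗ[ℂ] K)
    (hΨ : ∀ M : CStarMatrix (Fin n) (Fin n) L, 0 ≤ M → 0 ≤ M.map Ψ) :
    CStarMatrix (Fin n) (Fin n) L →ₚ[ℂ] CStarMatrix (Fin n) (Fin n) K :=
  PositiveLinearMap.mk₀ (CStarMatrix.mapₗ Ψ) hΨ

theorem cstarMatrixMap_one {n : ℕ} {Ψ : L →ₗ[ℂ] K}
    (hΨ : ∀ M : CStarMatrix (Fin n) (Fin n) L, 0 ≤ M → 0 ≤ M.map Ψ) (hΨ_one : Ψ 1 = 1) :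
    cstarMatrixMap Ψ hΨ 1 = 1 :=
  Matrix.map_one Ψ (map_zero Ψ) hΨ_one

end MatrixMaps

/-! ## The subordination function over the coefficients -/

section Intertwining

open PowerSeries

variable {K : Type u} {L : Type v} [CStarAlgebra K] [CStarAlgebra L] {A : StarSubalgebra ℂ K}
  {B : StarSubalgebra ℂ L} {X : K} {Y : L} {hXA : AlgebraicallyFree A X}
  {hYB : AlgebraicallyFree B Y} {Ψ : L →ₗ[ℂ] K}

/-- The restriction `M_n(B⟨Y⟩) → M_n(A⟨X⟩)` of a linear map, applied entrywise. -/
noncomputable def polyMatrixMap (n : ℕ) (Ψ : L →ₗ[ℂ] K)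
    (hΨ_maps : ∀ p ∈ polyAlgebra B Y, Ψ p ∈ polyAlgebra A X) :
    Matrix (Fin n) (Fin n) (polyAlgebra B Y) →+ Matrix (Fin n) (Fin n) (polyAlgebra A X) :=
  (Ψ.restrict (p := Subalgebra.toSubmodule (polyAlgebra B Y))
    (q := Subalgebra.toSubmodule (polyAlgebra A X)) hΨ_maps).toAddMonoidHom.mapMatrix

/-- The free difference quotient, applied entrywise. -/
noncomputable def matrixDifferenceQuotient (n : ℕ) (h : AlgebraicallyFree A X) :
    Matrix (Fin n) (Fin n) (polyAlgebra A X) →+ Matrix (Fin n) (Fin n) (K ⊗[ℂ] K) :=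
  (freeDifferenceQuotientIn h).toAddMonoidHom.mapMatrix

theorem matrixDifferenceQuotient_eq_zero_iff {n : ℕ} (h : AlgebraicallyFree A X)
    (p : Matrix (Fin n) (Fin n) (polyAlgebra A X)) :
    matrixDifferenceQuotient n h p = 0 ↔ ∀ i j, (p i j : K) ∈ A := by
  simp only [← freeDifferenceQuotientIn_eq_zero_iff h]
  exact Matrix.ext_iff.symm

theorem matrixDifferenceQuotient_diagonal_polyGen (n : ℕ) (h : AlgebraicallyFree A X) :
    matrixDifferenceQuotient n h (Matrix.diagonal fun _ => polyGen A X) = 1 :=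
  (Matrix.diagonal_map (map_zero _)).trans
    (congrArg Matrix.diagonal (funext fun _ => freeDifferenceQuotientIn_gen h))

variable {hΨ_maps : ∀ p ∈ polyAlgebra B Y, Ψ p ∈ polyAlgebra A X}

theorem map_mem_of_map_freeDifferenceQuotientIn
    (hΨ_comul : ∀ p : polyAlgebra B Y,
      TensorProduct.map Ψ Ψ (freeDifferenceQuotientIn hYB p) =
        freeDifferenceQuotientIn hXA ⟨Ψ p, hΨ_maps p p.2⟩) {b : L} (hb : b ∈ B) : Ψ b ∈ A := by
  have h := hΨ_comul (polyCoeff B Y ⟨b, hb⟩)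
  rwa [(freeDifferenceQuotientIn_eq_zero_iff hYB _).2 hb, map_zero, eq_comm,
    freeDifferenceQuotientIn_eq_zero_iff] at h

theorem coeff_subordination_polyMatrixMap_mem
    (hΨ_comul : ∀ p : polyAlgebra B Y,
      TensorProduct.map Ψ Ψ (freeDifferenceQuotientIn hYB p) =
        freeDifferenceQuotientIn hXA ⟨Ψ p, hΨ_maps p p.2⟩)
    {n : ℕ} {b : Matrix (Fin n) (Fin n) (polyAlgebra B Y)} (hb : ∀ i j, (b i j : L) ∈ B)
    (hu : IsUnit (PowerSeries.X * C (Matrix.diagonal fun _ => polyGen B Y) - C b))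
    (hφu : IsUnit (coeffMap (polyMatrixMap n Ψ hΨ_maps)
      (Ring.inverse (PowerSeries.X * C (Matrix.diagonal fun _ => polyGen B Y) - C b))))
    (k : ℕ) (i j : Fin n) :
    ((coeff k (subordination (coeffMap (polyMatrixMap n Ψ hΨ_maps))
      (PowerSeries.X * C (Matrix.diagonal fun _ => polyGen A X))
      (PowerSeries.X * C (Matrix.diagonal fun _ => polyGen B Y) - C b)) :
        Matrix (Fin n) (Fin n) (polyAlgebra A X)) i j : K) ∈ A := by
  have hΨ_tmul : ∀ p q : L, TensorProduct.map Ψ Ψ ((p ⊗ₜ 1) * (1 ⊗ₜ q)) =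
      (Ψ p ⊗ₜ 1) * (1 ⊗ₜ Ψ q) := by simp
  refine (matrixDifferenceQuotient_eq_zero_iff hXA _).1 ?_ i j
  exact map_coeff_subordination_eq_zero (φ := polyMatrixMap n Ψ hΨ_maps)
    (isTwistedDerivation_freeDifferenceQuotientIn hYB).mapMatrix
    (isTwistedDerivation_freeDifferenceQuotientIn hXA).mapMatrix
    (θ := (TensorProduct.map Ψ Ψ).toAddMonoidHom.mapMatrix)
    (fun p => Matrix.ext fun i j => hΨ_comul (p i j))
    (mapMatrix_mul_mapMatrix fun p q => hΨ_tmul p q)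
    (matrixDifferenceQuotient_diagonal_polyGen n hYB)
    ((matrixDifferenceQuotient_eq_zero_iff hYB b).2 hb)
    (matrixDifferenceQuotient_diagonal_polyGen n hXA) hu hφu k

end Intertwining

section Subordination

variable {K : Type u} {L : Type v} [CStarAlgebra K] [PartialOrder K] [StarOrderedRing K]
  [CStarAlgebra L] [PartialOrder L] [StarOrderedRing L]
  {A : StarSubalgebra ℂ K} [IsClosed (A : Set K)] {B : StarSubalgebra ℂ L} [IsClosed (B : Set L)]
  {X : K} {Y : L} {Ψ : L →ₗ[ℂ] K} {n : ℕ} {β : CStarMatrix (Fin n) (Fin n) B}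

theorem isUnit_polyMatrixMap_polyMatrixCoeff
    {hΨ_maps : ∀ p ∈ polyAlgebra B Y, Ψ p ∈ polyAlgebra A X}
    (hΨ : ∀ M : CStarMatrix (Fin n) (Fin n) L, 0 ≤ M → 0 ≤ M.map Ψ) (hΨ_one : Ψ 1 = 1)
    (hΨ_coeff : ∀ b ∈ B, Ψ b ∈ A) (hβ : β ∈ upperHalfPlane (CStarMatrix (Fin n) (Fin n) B)) :
    IsUnit (polyMatrixMap n Ψ hΨ_maps (polyMatrixCoeff n B Y β)) := by
  obtain ⟨a, ha⟩ := exists_cstarMatrixIncl_eq (A := A)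
    (M := cstarMatrixMap Ψ hΨ (cstarMatrixIncl n B β)) fun i j => hΨ_coeff _ (β i j).2
  have ha_mem : a ∈ upperHalfPlane (CStarMatrix (Fin n) (Fin n) A) := by
    refine mem_upperHalfPlane_of_map _ (cstarMatrixIncl_injective n A) (ha ▸ ?_)
    exact map_mem_upperHalfPlane _ (cstarMatrixMap_one hΨ hΨ_one)
      (map_mem_upperHalfPlane (cstarMatrixIncl n B) (map_one _) hβ)
  have ha_coeff : polyMatrixMap n Ψ hΨ_maps (polyMatrixCoeff n B Y β) =
      polyMatrixCoeff n A X a :=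
    Matrix.ext fun i j => Subtype.ext (congrFun (congrFun ha i) j).symm
  exact ha_coeff ▸ (isUnit_of_mem_upperHalfPlane ha_mem).map _

theorem exists_cstarMatrixIncl_eq_subordination {hXA : AlgebraicallyFree A X}
    (hY : IsSelfAdjoint Y) {hYB : AlgebraicallyFree B Y}
    (hΨ : ∀ M : CStarMatrix (Fin n) (Fin n) L, 0 ≤ M → 0 ≤ M.map Ψ) (hΨ_one : Ψ 1 = 1)
    {hΨ_maps : ∀ p ∈ polyAlgebra B Y, Ψ p ∈ polyAlgebra A X}
    (hΨ_comul : ∀ p : polyAlgebra B Y,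
      TensorProduct.map Ψ Ψ (freeDifferenceQuotientIn hYB p) =
        freeDifferenceQuotientIn hXA ⟨Ψ p, hΨ_maps p p.2⟩)
    (hβ : β ∈ upperHalfPlane (CStarMatrix (Fin n) (Fin n) B)) :
    ∃ α, cstarMatrixIncl n A α = subordination (cstarMatrixMap Ψ hΨ) (tensorOne X n)
      (tensorOne Y n - cstarMatrixIncl n B β) := by
  have hβ_incl := map_mem_upperHalfPlane (cstarMatrixIncl n B) (map_one _) hβ
  have hβ_unit : IsUnit (polyMatrixCoeff n B Y β) := (isUnit_of_mem_upperHalfPlane hβ).map _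
  have hφβ : IsUnit (polyMatrixMap n Ψ hΨ_maps (Ring.inverse (-polyMatrixCoeff n B Y β))) := by
    rw [← map_neg, ← map_ringInverse _ (isUnit_of_mem_upperHalfPlane hβ).neg, ← zero_sub]
    exact isUnit_polyMatrixMap_polyMatrixCoeff hΨ hΨ_one
      (fun b => map_mem_of_map_freeDifferenceQuotientIn hΨ_comul)
      (inverse_sub_mem_upperHalfPlane (IsSelfAdjoint.zero _) hβ)
  have hu := isUnit_X_mul_C_sub_C (Matrix.diagonal fun _ => polyGen B Y) hβ_unit
  have hφu := isUnit_coeffMap_inverse_X_mul_C_sub_C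
    (a := Matrix.diagonal fun _ => polyGen B Y) hβ_unit hφβ
  have hzY : ∀ z : ℝ, IsSelfAdjoint (z • tensorOne Y n) := fun z =>
    (IsSelfAdjoint.all z).smul (isSelfAdjoint_tensorOne hY n)
  let Φ : CStarMatrix (Fin n) (Fin n) L →L[ℝ] CStarMatrix (Fin n) (Fin n) K :=
    ContinuousLinearMap.restrictScalars ℝ
      ⟨(cstarMatrixMap Ψ hΨ).toLinearMap, map_continuous (cstarMatrixMap Ψ hΨ)⟩
  have hmem := subordination_mem_of_coeff_mem (f := polyMatrixVal n B Y)
    (g := polyMatrixVal n A X) (Φ := Φ) (fun _ => rfl) hu hφu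
    (Q := (cstarMatrixInclₗᵢ n A).range.restrictScalars ℝ) (fun z => ?_) (fun z => ?_)
    (isClosed_range_cstarMatrixInclₗᵢ n A)
    (x := Matrix.diagonal fun _ => polyGen A X) fun k => exists_cstarMatrixIncl_eq
      (coeff_subordination_polyMatrixMap_mem hΨ_comul (fun i j => (β i j).2) hu hφu k)
  · rwa [polyMatrixVal_diagonal_polyGen, polyMatrixVal_diagonal_polyGen] at hmem
  · rw [polyMatrixVal_diagonal_polyGen]
    exact isUnit_sub_of_mem_upperHalfPlane (hzY z) hβ_incl
  · rw [polyMatrixVal_diagonal_polyGen]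
    exact isUnit_map_inverse_sub (cstarMatrixMap_one hΨ hΨ_one) (hzY z) hβ_incl

end Subordination

theorem mainTheorem2_general {K : Type u} {L : Type v}
    [CStarAlgebra K] [PartialOrder K] [StarOrderedRing K]
    [CStarAlgebra L] [PartialOrder L] [StarOrderedRing L]
    (A : StarSubalgebra ℂ K) [IsClosed (A : Set K)]
    (B : StarSubalgebra ℂ L) [IsClosed (B : Set L)]
    (X : K) (hX : IsSelfAdjoint X) (hXA : AlgebraicallyFree A X)
    (Y : L) (hY : IsSelfAdjoint Y) (hYB : AlgebraicallyFree B Y)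
    (n : ℕ) (Ψ : L →ₗ[ℂ] K)
    (hΨ : ∀ M : CStarMatrix (Fin n) (Fin n) L, 0 ≤ M → 0 ≤ M.map Ψ) (hΨ_one : Ψ 1 = 1)
    (hΨ_maps : ∀ p ∈ polyAlgebra B Y, Ψ p ∈ polyAlgebra A X)
    (hΨ_comul : ∀ p : polyAlgebra B Y,
      TensorProduct.map Ψ Ψ (freeDifferenceQuotientIn hYB p) =
        freeDifferenceQuotientIn hXA ⟨Ψ p, hΨ_maps p p.2⟩) :
    ∃ F : CStarMatrix (Fin n) (Fin n) B → CStarMatrix (Fin n) (Fin n) A,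
      DifferentiableOn ℂ F (upperHalfPlane (CStarMatrix (Fin n) (Fin n) B)) ∧
      Set.MapsTo F (upperHalfPlane (CStarMatrix (Fin n) (Fin n) B))
        (upperHalfPlane (CStarMatrix (Fin n) (Fin n) A)) ∧
      ∀ β ∈ upperHalfPlane (CStarMatrix (Fin n) (Fin n) B),
        IsUnit (tensorOne Y n - β.map Subtype.val) ∧
        IsUnit (tensorOne X n - (F β).map Subtype.val) ∧
        (Ring.inverse (tensorOne Y n - β.map Subtype.val)).map Ψ =
          Ring.inverse (tensorOne X n - (F β).map Subtype.val) := by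
  have hΨn := cstarMatrixMap_one hΨ hΨ_one
  have hXn := isSelfAdjoint_tensorOne hX n
  have hYn := isSelfAdjoint_tensorOne hY n
  have hincl : ∀ β ∈ upperHalfPlane (CStarMatrix (Fin n) (Fin n) B),
      cstarMatrixIncl n B β ∈ upperHalfPlane _ := fun β hβ =>
    map_mem_upperHalfPlane (cstarMatrixIncl n B) (map_one _) hβ
  choose! F hF using fun β (hβ : β ∈ upperHalfPlane (CStarMatrix (Fin n) (Fin n) B)) =>
    exists_cstarMatrixIncl_eq_subordination hY hΨ hΨ_one hΨ_comul hβ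
  refine ⟨F, fun β hβ => ?_, fun β hβ => ?_, fun β hβ => ?_⟩
  · have hd := differentiableAt_subordination hΨn hYn (tensorOne X n)
      (ι := (cstarMatrixInclₗᵢ n B).toContinuousLinearMap) (hincl β hβ)
    have hd' := hd.congr_of_eventuallyEq ((isOpen_upperHalfPlane.eventually_mem hβ).mono hF)
    exact (differentiableAt_of_linearIsometry_comp (cstarMatrixInclₗᵢ n A)
      (isClosed_range_cstarMatrixInclₗᵢ n A) hd').differentiableWithinAt
  · exact mem_upperHalfPlane_of_map _ (cstarMatrixIncl_injective n A)
      (hF β hβ ▸ subordination_mem_upperHalfPlane hΨn hYn hXn (hincl β hβ))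
  · have hunit := isUnit_map_inverse_sub hΨn hYn (hincl β hβ)
    have hres : tensorOne X n - cstarMatrixIncl n A (F β) = _ :=
      (congrArg _ (hF β hβ)).trans (sub_subordination _ _ _)
    refine ⟨isUnit_sub_of_mem_upperHalfPlane hYn (hincl β hβ),
      (congrArg IsUnit hres).mpr hunit.ringInverse, ?_⟩
    exact ((congrArg Ring.inverse hres).trans (Ring.inverse_inverse hunit)).symm

theorem mainTheorem2 {K : Type u} {L : Type v}
    [CStarAlgebra K] [PartialOrder K] [StarOrderedRing K]
    [CStarAlgebra L] [PartialOrder L] [StarOrderedRing L]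
    (A : StarSubalgebra ℂ K) [IsClosed (A : Set K)]
    (B : StarSubalgebra ℂ L) [IsClosed (B : Set L)]
    (X : K) (hX : IsSelfAdjoint X) (hXA : AlgebraicallyFree A X)
    (Y : L) (hY : IsSelfAdjoint Y) (hYB : AlgebraicallyFree B Y)
    (Ψ : L →CP K) (hΨ_one : Ψ 1 = 1)
    (hΨ_maps : ∀ p ∈ polyAlgebra B Y, Ψ p ∈ polyAlgebra A X)
    (hΨ_comul : ∀ p : polyAlgebra B Y,
      TensorProduct.map Ψ.toLinearMap Ψ.toLinearMap (freeDifferenceQuotientIn hYB p) =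
        freeDifferenceQuotientIn hXA ⟨Ψ p, hΨ_maps p p.2⟩)
    (hX_closable : (freeDifferenceQuotientOp hXA).IsClosable)
    (hY_closable : (freeDifferenceQuotientOp hYB).IsClosable)
    (n : ℕ) :
    ∃ F : CStarMatrix (Fin n) (Fin n) B → CStarMatrix (Fin n) (Fin n) A,
      DifferentiableOn ℂ F (upperHalfPlane (CStarMatrix (Fin n) (Fin n) B)) ∧
      Set.MapsTo F (upperHalfPlane (CStarMatrix (Fin n) (Fin n) B))
        (upperHalfPlane (CStarMatrix (Fin n) (Fin n) A)) ∧
      ∀ β ∈ upperHalfPlane (CStarMatrix (Fin n) (Fin n) B),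
        IsUnit (tensorOne Y n - β.map Subtype.val) ∧
        IsUnit (tensorOne X n - (F β).map Subtype.val) ∧
        (Ring.inverse (tensorOne Y n - β.map Subtype.val)).map Ψ =
          Ring.inverse (tensorOne X n - (F β).map Subtype.val) :=
  mainTheorem2_general A B X hX hXA Y hY hYB n Ψ.toLinearMap
    (fun M hM => Ψ.map_cstarMatrix_nonneg M hM) hΨ_one hΨ_maps hΨ_comul
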